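/- Let $\mathbb X\subset\mathbb R^n$ be Lebesgue measurable, and let $(X_t)$ be a time-homogeneous Markov process on $\mathbb X$ with transition densities $p^t(x,y)\ge 0$ ($t>0$, jointly measurable in $x,y\in\mathbb X$, densities with respect to Lebesgue measure). Assume that it has a unique stationary probability measure $\mu$, that $d\mu=\pi\,dx$ with $\pi$ continuous and strictly positive, and that detailed balance $p^t(x,y)\pi(x)=p^t(y,x)\pi(y)$ holds for all $x,y\in\mathbb X$, $t>0$. Fix $\tau>0$, write $p:=p^\tau$, and fix $\mathbb Z\subset\mathbb R^r$ with Lebesgue measure $0<|\mathbb Z|<\infty$. For a continuous $\vartheta:\mathbb X\to\mathbb Z$ let $\nu_\vartheta$ be the image of $\mu$ under $\vartheta$, and let $(\mu_z)_{z\in\mathbb Z}$ be the disintegration of $\mu$ along $\vartheta$: $\mu_z$ is the conditional probability distribution of $x\sim\mu$ given $\vartheta(x)=z$. Thus, for $\nu_\vartheta$-almost every $z$, $\mu_z$ is a probability measure concentrated on the level set $\Sigma_\vartheta(z)=\{x:\vartheta(x)=z\}$, and $\int_{\mathbb Z}\int_{\Sigma_\vartheta(z)} f\,d\mu_z\,d\nu_\vartheta(z)=\int_{\mathbb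 X} f\,d\mu$ for measurable $f\ge 0$. Define $$\mathscr L_L(\vartheta)=\frac1{|\mathbb Z|}\inf_{p_L}\int_{\mathbb X}\big\|p(x,\cdot)-p_L(\vartheta(x),\cdot)\big\|_{L^1(\mathbb X)}\,d\mu(x),$$ where the infimum is over measurable $p_L:\mathbb Z\times\mathbb X\to[0,\infty)$, and $$\widetilde{\mathscr L}_L(\vartheta)=\frac1{|\mathbb Z|}\int_{\mathbb Z}\int_{\Sigma_\vartheta(z)}\int_{\Sigma_\vartheta(z)}\big\|p(x^{(1)},\cdot)-p(x^{(2)},\cdot)\big\|_{L^1}\,d\mu_z(x^{(1)})\,d\mu_z(x^{(2)})\,d\nu_\vartheta(z),$$ $$\widetilde{\mathscr L}_D(\vartheta)=\frac1{|\mathbb Z|}\int_{\mathbb Z}\int_{\Sigma_\vartheta(z)}\int_{\Sigma_\vartheta(z)}\Big\|\frac{p(\cdot,y^{(1)})}{\pi(y^{(1)})}-\frac{p(\cdot,y^{(2)})}{\pi(y^{(2)})}\Big\|_{L^1_\mu}\,d\mu_z(y^{(1)})\,d\mu_z(y^{(2)})\,d\nu_\vartheta(z).$$ Let $\xi\in C(\mathbb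 X,\mathbb Z)$ be a minimizer of $\mathscr L_L$ over $C(\mathbb X,\mathbb Z)$ and set $\varepsilon:=\mathscr L_L(\xi)$. Then $$\widetilde{\mathscr L}_L(\xi)\le 2\varepsilon\qquad\text{and}\qquad\widetilde{\mathscr L}_D(\xi)\le 2\varepsilon.$$ Moreover, every minimizer $\xi_L$ of $\widetilde{\mathscr L}_L$ over $C(\mathbb X,\mathbb Z)$ and every minimizer $\xi_D$ of $\widetilde{\mathscr L}_D$ over $C(\mathbb X,\mathbb Z)$ satisfy $$\mathscr L_L(\xi_L)\le 2\varepsilon\qquad\text{and}\qquad\mathscr L_L(\xi_D)\le 2\varepsilon.$$ -/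

import Mathlib

open MeasureTheory ProbabilityTheory
open scoped ENNReal

/-- Lebesgue measure on `X ⊆ ℝⁿ`. -/
noncomputable def lebesgueOn {n : ℕ} (X : Set (EuclideanSpace ℝ (Fin n))) : Measure X :=
  (volume : Measure (EuclideanSpace ℝ (Fin n))).comap Subtype.val

/-- A continuous-time Markov process on a state space `X ⊆ ℝⁿ`, given by its transition
probabilities `P t` for `t > 0`, with transition densities `p t x y` (with respect to Lebesgue
measure on `X`), and a unique stationary probability measure, which has a continuous strictly
positive Lebesgue density `π`, and with respect to which the process is reversible. -/
structure ReversibleSystem {n : ℕ} (X : Set (EuclideanSpace ℝ (Fin n))) where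
  /-- the state space is Lebesgue measurable -/
  nullMeasurableSet : NullMeasurableSet X volume
  /-- the transition probability function, relevant for `t > 0` -/
  P : ℝ → Kernel X X
  isMarkovKernel : ∀ t, 0 < t → IsMarkovKernel (P t)
  /-- the Chapman-Kolmogorov equation (Markov property) -/
  chapman_kolmogorov : ∀ s t, 0 < s → 0 < t → P (s + t) = (P t).comp (P s)
  /-- the transition kernel `p t x y` -/
  p : ℝ → X → X → ℝ
  p_nonneg : ∀ t, 0 < t → ∀ x y, 0 ≤ p t x y
  measurable_p : ∀ t, 0 < t → Measurable (Function.uncurry (p t))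
  P_eq : ∀ t, 0 < t → ∀ x,
    P t x = (lebesgueOn X).withDensity (fun y => ENNReal.ofReal (p t x y))
  /-- the stationary density -/
  π : X → ℝ
  continuous_π : Continuous π
  π_pos : ∀ x, 0 < π x
  lintegral_π : ∫⁻ x, ENNReal.ofReal (π x) ∂(lebesgueOn X) = 1
  invariant : ∀ t, 0 < t →
    Kernel.Invariant (P t) ((lebesgueOn X).withDensity (fun x => ENNReal.ofReal (π x)))
  invariant_unique : ∀ ν : Measure X, IsProbabilityMeasure ν →
    (∀ t, 0 < t → Kernel.Invariant (P t) ν) →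
      ν = (lebesgueOn X).withDensity (fun x => ENNReal.ofReal (π x))
  detailed_balance : ∀ t, 0 < t → ∀ x y, p t x y * π x = p t y x * π y

namespace ReversibleSystem

variable {n r : ℕ} {X : Set (EuclideanSpace ℝ (Fin n))} {Z : Set (EuclideanSpace ℝ (Fin r))}

/-- The stationary measure `dμ = π dx`. -/
noncomputable def μ (S : ReversibleSystem X) : Measure X :=
  (lebesgueOn X).withDensity (fun x => ENNReal.ofReal (S.π x))

instance isProbabilityMeasure_μ (S : ReversibleSystem X) : IsProbabilityMeasure S.μ :=
  ⟨by rw [μ, withDensity_apply _ MeasurableSet.univ, Measure.restrict_univ, S.lintegral_π]⟩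

/-- The norm of `𝕂 = L¹_{μ × λ}(X²)`, with values in `[0, ∞]`:
`‖f‖_𝕂 = ∫_X ‖f(x, ·)‖_{L¹} dμ(x)`. -/
noncomputable def normK (S : ReversibleSystem X) (f : X → X → ℝ) : ℝ≥0∞ :=
  ∫⁻ x, ∫⁻ y, ‖f x y‖ₑ ∂(lebesgueOn X) ∂S.μ

/-- The lumpability loss function at lag time `τ`:
`|Z|⁻¹ inf_{p_L} ‖p(∗, ·) - p_L(ϑ(∗), ·)‖_𝕂` over measurable `p_L : Z × X → [0, ∞)`. -/
noncomputable def lossL (S : ReversibleSystem X) (τ : ℝ) (ϑ : C(X, Z)) : ℝ≥0∞ :=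
  (volume Z)⁻¹ *
    ⨅ pL ∈ {pL : Z → X → ℝ | Measurable (Function.uncurry pL) ∧ ∀ z y, 0 ≤ pL z y},
      S.normK (fun x y => S.p τ x y - pL (ϑ x) y)

/-- The image of the stationary measure under the reaction coordinate. -/
noncomputable def imageMeasure (S : ReversibleSystem X) (ϑ : C(X, Z)) : Measure Z :=
  S.μ.map ϑ

/-- The stationary measure `μ_z` on the level set `{x | ϑ x = z}`: the regular conditional
distribution of `x` given `ϑ x = z`, for `x` distributed according to `μ`. It is taken in the
standard Borel space `ℝⁿ` and pulled back to `X`, as `X` need not be a Borel set. -/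
noncomputable def levelMeasure (S : ReversibleSystem X) (ϑ : C(X, Z)) (z : Z) : Measure X :=
  (condDistrib (fun x : X => (x : EuclideanSpace ℝ (Fin n))) ϑ S.μ z).comap Subtype.val

/-- The differential lumpability loss function at lag time `τ`: the average over the level sets
of `‖p(x₁, ·) - p(x₂, ·)‖_{L¹}`. -/
noncomputable def diffLossL (S : ReversibleSystem X) (τ : ℝ) (ϑ : C(X, Z)) : ℝ≥0∞ :=
  (volume Z)⁻¹ *
    ∫⁻ z, ∫⁻ x₂, ∫⁻ x₁, (∫⁻ y, ‖S.p τ x₁ y - S.p τ x₂ y‖ₑ ∂(lebesgueOn X))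
      ∂(S.levelMeasure ϑ z) ∂(S.levelMeasure ϑ z) ∂(S.imageMeasure ϑ)

/-- The differential deflatability loss function at lag time `τ`: the average over the level sets
of `‖p(·, y₁) / π(y₁) - p(·, y₂) / π(y₂)‖_{L¹_μ}`. -/
noncomputable def diffLossD (S : ReversibleSystem X) (τ : ℝ) (ϑ : C(X, Z)) : ℝ≥0∞ :=
  (volume Z)⁻¹ *
    ∫⁻ z, ∫⁻ y₂, ∫⁻ y₁, (∫⁻ x, ‖S.p τ x y₁ / S.π y₁ - S.p τ x y₂ / S.π y₂‖ₑ ∂S.μ)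
      ∂(S.levelMeasure ϑ z) ∂(S.levelMeasure ϑ z) ∂(S.imageMeasure ϑ)

end ReversibleSystem

/-!
Both differential losses are the same functional. Detailed balance gives
`π(x) (p(x, y₁) / π(y₁) - p(x, y₂) / π(y₂)) = p(y₁, x) - p(y₂, x)`, so the integrands of
`diffLossL` and `diffLossD` agree (`diffLossD_eq_diffLossL`).

This functional is comparable to the lumpability loss, `lossL ≤ diffLossL ≤ 2 * lossL`.
Disintegrating `μ` along `ϑ`, the integrals defining `lossL` become iterated integrals over the
level sets, on which `p_L(z, ·)` plays the role of a centre of the functions `p(x, ·)`.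

* Upper bound (`diffLossL_le_two_mul_lossL`): for any competitor `p_L`, the triangle inequality
  through `p_L(z, ·)` bounds the mean distance between two points of a level set by twice the mean
  distance to the centre.
* Lower bound (`lossL_le_diffLossL`): the competitor `p_L(z, y) = ∫ p(x, y) dμ_z(x)`, the mean over
  the level set, is by Jensen's inequality at mean distance at most the mean distance between two
  points.

A minimizer `ξ'` of the differential loss thus satisfies
`lossL ξ' ≤ diffLossL ξ' ≤ diffLossL ξ ≤ 2 * lossL ξ`.

The measure-theoretic point is that `X` is only Lebesgue measurable, so the conditional
distributions, which live on `ℝⁿ`, have to be transported to `X`. This is done through a Borel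
subset of full measure in `X`, and yields a kernel from `Z` to `X` which agrees almost everywhere
with `levelMeasure` and disintegrates `μ` (`exists_kernel_disintegration`).
-/

/-! ### Pulling a kernel back to a subtype -/

/-- A set `A` need not be measurable for a kernel `κ` into `E` to be pulled back to it: pulling back
to a measurable subset `B` of `A` and pushing forward to `A` ignores the part outside `B`. -/
theorem exists_kernel_subtype {α E : Type*} [MeasurableSpace α] [MeasurableSpace E]
    (κ : Kernel α E) [IsFiniteKernel κ] {A B : Set E} (hB : MeasurableSet B) (hBA : B ⊆ A) :
    ∃ η : Kernel α A, IsFiniteKernel η ∧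
      ∀ a, ∀ t : Set E, MeasurableSet t → η a (Subtype.val ⁻¹' t) = κ a (t ∩ B) := by
  have hincl : Measurable (Set.inclusion hBA) := measurable_inclusion hBA
  refine ⟨(κ.comapRight (MeasurableEmbedding.subtype_coe hB)).map (Set.inclusion hBA),
    inferInstance, fun a t ht => ?_⟩
  rw [Kernel.map_apply' _ hincl _ (measurable_subtype_coe ht),
    Kernel.comapRight_apply' _ _ _ (hincl (measurable_subtype_coe ht)), ← Set.preimage_comp]
  congr 1
  ext x
  simp [and_comm]

/-- If a subset `B` of `A` has null complement then `A` is null-measurable, so `Measure.comap` does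
not take its junk value `0`, and the pullback to `A` sees only `B`. -/
theorem comap_subtype_val_apply {E : Type*} [MeasurableSpace E] {m : Measure E} {A B : Set E}
    (hBA : B ⊆ A) (hm : m Bᶜ = 0) {t : Set E} (ht : MeasurableSet t) :
    m.comap (Subtype.val : A → E) (Subtype.val ⁻¹' t) = m (t ∩ B) := by
  have hA : m Aᶜ = 0 := measure_mono_null (Set.compl_subset_compl.2 hBA) hm
  have hAnull : NullMeasurableSet A m := (NullMeasurableSet.of_null hA).of_compl
  rw [Measure.comap_apply₀ _ _ Subtype.val_injective ?_
    (measurable_subtype_coe ht).nullMeasurableSet, Subtype.image_preimage_coe, Set.inter_comm]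
  · refine measure_congr (Filter.EventuallyEq.rfl.inter ?_)
    exact (ae_eq_univ.2 hA).trans (ae_eq_univ.2 hm).symm
  · rintro _ ⟨t, ht, rfl⟩
    rw [Subtype.image_preimage_coe]
    exact hAnull.inter ht.nullMeasurableSet

/-! ### Mean distance to the mean -/

/-- Jensen's inequality for the distance to the mean. No integrability is needed: if `f` is not
integrable then the right-hand side is infinite. -/
theorem enorm_sub_integral_le_lintegral {α : Type*} [MeasurableSpace α] {m : Measure α}
    [IsProbabilityMeasure m] {f : α → ℝ} (hf : Measurable f) (c : ℝ) :
    ‖c - ∫ a, f a ∂m‖ₑ ≤ ∫⁻ a, ‖f a - c‖ₑ ∂m := by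
  by_cases hi : Integrable f m
  · have h : c - ∫ a, f a ∂m = ∫ a, (c - f a) ∂m := by
      rw [integral_sub (integrable_const c) hi]
      simp
    rw [h]
    refine (enorm_integral_le_lintegral_enorm _).trans_eq (lintegral_congr fun a => ?_)
    rw [← enorm_neg, neg_sub]
  · have h : ∫⁻ a, ‖f a - c‖ₑ ∂m = ∞ := by
      by_contra hne
      refine hi ?_
      have : Integrable (fun a => f a - c) m :=
        ⟨(hf.sub_const c).aestronglyMeasurable, Ne.lt_top hne⟩
      exact (this.add (integrable_const c)).congr (.of_forall fun a => sub_add_cancel (f a) c)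
    rw [h]
    exact le_top

namespace ReversibleSystem

variable {n r : ℕ} {X : Set (EuclideanSpace ℝ (Fin n))} {Z : Set (EuclideanSpace ℝ (Fin r))}

/-! ### Disintegration of the stationary measure -/

theorem measurable_π (S : ReversibleSystem X) : Measurable S.π := S.continuous_π.measurable

/-- Lebesgue measure on `X` has a density with respect to the finite measure `μ`. -/
theorem sFinite_lebesgueOn (S : ReversibleSystem X) : SFinite (lebesgueOn X) := by
  have h : (S.μ.withDensity fun x => (ENNReal.ofReal (S.π x))⁻¹) = lebesgueOn X :=
    withDensity_inv_same S.measurable_π.ennreal_ofReal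
      (.of_forall fun x => by simpa using S.π_pos x) (.of_forall fun x => ENNReal.ofReal_ne_top)
  rw [← h]
  infer_instance

/-- As `X` is Lebesgue measurable, it has a Borel subset whose complement `μ` does not charge. -/
theorem exists_measurableSet_subset_full (S : ReversibleSystem X) :
    ∃ B ⊆ X, MeasurableSet B ∧ S.μ (Subtype.val ⁻¹' Bᶜ) = 0 := by
  obtain ⟨B, hBX, hB, hae⟩ := S.nullMeasurableSet.exists_measurable_subset_ae_eq
  refine ⟨B, hBX, hB, withDensity_absolutelyContinuous (lebesgueOn X) _ ?_⟩
  rw [lebesgueOn, Measure.comap_apply₀ _ _ Subtype.val_injective ?_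
    (measurable_subtype_coe hB.compl).nullMeasurableSet, Subtype.image_preimage_coe]
  · exact (ae_le_set.1 hae.symm.le)
  · rintro _ ⟨t, ht, rfl⟩
    rw [Subtype.image_preimage_coe]
    exact S.nullMeasurableSet.inter ht.nullMeasurableSet

/-- The measures on the level sets form, up to a null set of levels, a kernel from `Z` to `X`
consisting of probability measures and disintegrating `μ` along `ϑ`. -/
theorem exists_kernel_disintegration (S : ReversibleSystem X) (ϑ : C(X, Z)) :
    ∃ κ : Kernel Z X, IsFiniteKernel κ ∧
      (∀ᵐ z ∂S.imageMeasure ϑ, S.levelMeasure ϑ z = κ z) ∧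
      (∀ᵐ z ∂S.imageMeasure ϑ, IsProbabilityMeasure (κ z)) ∧
      S.imageMeasure ϑ ⊗ₘ κ = S.μ.map fun x => (ϑ x, x) := by
  obtain ⟨B, hBX, hB, hμB⟩ := S.exists_measurableSet_subset_full
  have hϑ : Measurable ϑ := ϑ.continuous.measurable
  have hfin : IsFiniteMeasure (S.imageMeasure ϑ) := by
    unfold imageMeasure; infer_instance
  set ρ := condDistrib (fun x : X => (x : EuclideanSpace ℝ (Fin n))) ϑ S.μ with hρ
  have hcomp : S.imageMeasure ϑ ⊗ₘ ρ =
      S.μ.map fun x => (ϑ x, (x : EuclideanSpace ℝ (Fin n))) :=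
    compProd_map_condDistrib measurable_subtype_coe.aemeasurable
  obtain ⟨κ, hκfin, hκ⟩ := exists_kernel_subtype ρ hB hBX
  have hnull : ∀ᵐ z ∂S.imageMeasure ϑ, ρ z Bᶜ = 0 := by
    have h0 : (S.imageMeasure ϑ ⊗ₘ ρ) (Set.univ ×ˢ Bᶜ) = 0 := by
      rw [hcomp, Measure.map_apply (by fun_prop) (MeasurableSet.univ.prod hB.compl)]
      simpa [Set.mk_preimage_prod] using! hμB
    rw [Measure.compProd_apply_prod MeasurableSet.univ hB.compl, Measure.restrict_univ,
      lintegral_eq_zero_iff (Kernel.measurable_coe _ hB.compl)] at h0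
    exact h0
  refine ⟨κ, hκfin, ?_, ?_, ?_⟩
  · filter_upwards [hnull] with z hz
    ext _ ⟨t, ht, rfl⟩
    rw [hκ z t ht, levelMeasure, comap_subtype_val_apply hBX hz ht]
  · filter_upwards [hnull] with z hz
    refine ⟨?_⟩
    rw [← Set.preimage_univ, hκ z _ MeasurableSet.univ, Set.univ_inter]
    exact (prob_compl_eq_zero_iff hB).1 hz
  · refine Measure.ext_prod ?_
    rintro s _ hs ⟨t, ht, rfl⟩
    have hrect : (S.imageMeasure ϑ ⊗ₘ ρ) (s ×ˢ (t ∩ B)) =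
        S.μ (ϑ ⁻¹' s ∩ Subtype.val ⁻¹' (t ∩ B)) := by
      rw [hcomp, Measure.map_apply (by fun_prop) (hs.prod (ht.inter hB))]
      rfl
    rw [Measure.compProd_apply_prod hs (measurable_subtype_coe ht)]
    simp_rw [hκ _ t ht]
    rw [← Measure.compProd_apply_prod hs (ht.inter hB), hrect,
      Measure.map_apply (by fun_prop) (hs.prod (measurable_subtype_coe ht)), Set.mk_preimage_prod]
    refine measure_congr (Filter.EventuallyEq.rfl.inter ?_)
    rw [Set.preimage_inter]
    exact Filter.EventuallyEq.trans (Filter.EventuallyEq.rfl.inter (ae_eq_univ.2 hμB))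
      (by simp; rfl)

/-- Integration over `X` as iterated integration over the level sets of `ϑ`. -/
theorem lintegral_comp_eq_lintegral_kernel (S : ReversibleSystem X) {ϑ : C(X, Z)} {κ : Kernel Z X}
    [IsFiniteKernel κ] (hκ : S.imageMeasure ϑ ⊗ₘ κ = S.μ.map fun x => (ϑ x, x))
    {f : Z → X → ℝ≥0∞} (hf : Measurable (Function.uncurry f)) :
    ∫⁻ x, f (ϑ x) x ∂S.μ = ∫⁻ z, ∫⁻ x, f z x ∂(κ z) ∂(S.imageMeasure ϑ) := by
  have hϑ : Measurable ϑ := ϑ.continuous.measurable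
  have hfin : IsFiniteMeasure (S.imageMeasure ϑ) := by
    unfold imageMeasure; infer_instance
  have h := Measure.lintegral_compProd (μ := S.imageMeasure ϑ) (κ := κ) hf
  rw [hκ, lintegral_map hf (by fun_prop)] at h
  exact h

/-! ### Comparison of the loss functions -/

theorem diffLossD_eq_diffLossL (S : ReversibleSystem X) {τ : ℝ} (hτ : 0 < τ) (ϑ : C(X, Z)) :
    S.diffLossD τ ϑ = S.diffLossL τ ϑ := by
  have hp := S.measurable_p τ hτ
  have key : ∀ y₁ y₂, ∫⁻ x, ‖S.p τ x y₁ / S.π y₁ - S.p τ x y₂ / S.π y₂‖ₑ ∂S.μ =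
      ∫⁻ y, ‖S.p τ y₁ y - S.p τ y₂ y‖ₑ ∂(lebesgueOn X) := by
    intro y₁ y₂
    have hy (y : X) : Measurable fun x => S.p τ x y := hp.comp measurable_prodMk_right
    have hmeas : Measurable fun x => ‖S.p τ x y₁ / S.π y₁ - S.p τ x y₂ / S.π y₂‖ₑ :=
      (((hy y₁).div_const _).sub ((hy y₂).div_const _)).enorm
    rw [μ, lintegral_withDensity_eq_lintegral_mul _ S.measurable_π.ennreal_ofReal hmeas]
    refine lintegral_congr fun x => ?_
    have hbal (y : X) : S.π x * (S.p τ x y / S.π y) = S.p τ y x := by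
      have := S.detailed_balance τ hτ x y
      have := (S.π_pos y).ne'
      field_simp
      linarith
    rw [Pi.mul_apply, ← Real.enorm_of_nonneg (S.π_pos x).le, ← enorm_mul, mul_sub, hbal, hbal]
  simp only [diffLossD, diffLossL, key]

theorem diffLossL_le_two_mul_lossL (S : ReversibleSystem X) {τ : ℝ} (hτ : 0 < τ) (ϑ : C(X, Z)) :
    S.diffLossL τ ϑ ≤ 2 * S.lossL τ ϑ := by
  have hp := S.measurable_p τ hτ
  have := S.sFinite_lebesgueOn
  obtain ⟨κ, hfin, hlevel, hprob, hdis⟩ := S.exists_kernel_disintegration ϑ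
  rw [lossL, diffLossL, mul_left_comm]
  gcongr
  rw [ENNReal.mul_iInf_of_ne two_ne_zero ENNReal.ofNat_ne_top]
  refine le_iInf fun pL => ?_
  rw [ENNReal.mul_iInf_of_ne two_ne_zero ENNReal.ofNat_ne_top]
  refine le_iInf fun hpL => ?_
  obtain ⟨hpL, -⟩ := hpL
  -- `G z x` is the distance of `p(x, ·)` to the centre `p_L(z, ·)`.
  set G : Z → X → ℝ≥0∞ := fun z x => ∫⁻ y, ‖S.p τ x y - pL z y‖ₑ ∂(lebesgueOn X) with hG_def
  have hint : Measurable fun q : (Z × X) × X => ‖S.p τ q.1.2 q.2 - pL q.1.1 q.2‖ₑ :=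
    ((hp.comp ((measurable_snd.comp measurable_fst).prodMk measurable_snd)).sub
      (hpL.comp ((measurable_fst.comp measurable_fst).prodMk measurable_snd))).enorm
  have hG : Measurable (Function.uncurry G) := hint.lintegral_prod_right'
  have hGz (z : Z) : Measurable (G z) := hG.comp measurable_prodMk_left
  have hnorm : S.normK (fun x y => S.p τ x y - pL (ϑ x) y) =
      ∫⁻ z, ∫⁻ x, G z x ∂(κ z) ∂(S.imageMeasure ϑ) :=
    S.lintegral_comp_eq_lintegral_kernel hdis hG
  rw [hnorm, ← lintegral_const_mul _ hG.lintegral_kernel_prod_right]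
  refine lintegral_mono_ae ?_
  filter_upwards [hlevel, hprob] with z hz hz1
  rw [hz]
  have htri (x₁ x₂ : X) :
      ∫⁻ y, ‖S.p τ x₁ y - S.p τ x₂ y‖ₑ ∂(lebesgueOn X) ≤ G z x₁ + G z x₂ := by
    have h1 : Measurable fun y => ‖S.p τ x₁ y - pL z y‖ₑ :=
      hint.comp (measurable_prodMk_left (x := (z, x₁)))
    rw [hG_def, ← lintegral_add_left h1]
    refine lintegral_mono fun y => ?_
    rw [← sub_sub_sub_cancel_right (S.p τ x₁ y) (S.p τ x₂ y) (pL z y)]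
    exact enorm_sub_le
  calc ∫⁻ x₂, ∫⁻ x₁, (∫⁻ y, ‖S.p τ x₁ y - S.p τ x₂ y‖ₑ ∂(lebesgueOn X)) ∂(κ z) ∂(κ z)
      ≤ ∫⁻ x₂, ∫⁻ x₁, (G z x₁ + G z x₂) ∂(κ z) ∂(κ z) :=
        lintegral_mono fun x₂ => lintegral_mono fun x₁ => htri x₁ x₂
    _ = ∫⁻ x₂, ((∫⁻ x₁, G z x₁ ∂(κ z)) + G z x₂) ∂(κ z) := by
        refine lintegral_congr fun x₂ => ?_
        rw [lintegral_add_left (hGz z), lintegral_const, measure_univ, mul_one]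
    _ = 2 * ∫⁻ x, G z x ∂(κ z) := by
        rw [lintegral_add_left measurable_const, lintegral_const, measure_univ, mul_one, two_mul]

theorem lossL_le_diffLossL (S : ReversibleSystem X) {τ : ℝ} (hτ : 0 < τ) (ϑ : C(X, Z)) :
    S.lossL τ ϑ ≤ S.diffLossL τ ϑ := by
  have hp := S.measurable_p τ hτ
  have := S.sFinite_lebesgueOn
  obtain ⟨κ, hfin, hlevel, hprob, hdis⟩ := S.exists_kernel_disintegration ϑ
  rw [lossL, diffLossL]
  gcongr
  -- The competitor is the mean over the level set; where the mean does not exist it is zero.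
  set pL : Z → X → ℝ := fun z y => ∫ x, S.p τ x y ∂(κ z) with hpL_def
  have hpL : Measurable (Function.uncurry pL) := by
    have hq : StronglyMeasurable fun q : (Z × X) × X => S.p τ q.2 q.1.2 :=
      (hp.comp (measurable_snd.prodMk (measurable_snd.comp measurable_fst))).stronglyMeasurable
    exact (hq.integral_kernel_prod_right' (κ := κ.comap Prod.fst measurable_fst)).measurable
  have hpL0 (z : Z) (y : X) : 0 ≤ pL z y := integral_nonneg fun x => S.p_nonneg τ hτ x y
  refine (iInf₂_le pL ⟨hpL, hpL0⟩).trans ?_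
  have hG : Measurable (Function.uncurry fun (z : Z) (x : X) =>
      ∫⁻ y, ‖S.p τ x y - pL z y‖ₑ ∂(lebesgueOn X)) := by
    have hint : Measurable fun q : (Z × X) × X => ‖S.p τ q.1.2 q.2 - pL q.1.1 q.2‖ₑ :=
      ((hp.comp ((measurable_snd.comp measurable_fst).prodMk measurable_snd)).sub
        (hpL.comp ((measurable_fst.comp measurable_fst).prodMk measurable_snd))).enorm
    exact hint.lintegral_prod_right'
  refine (S.lintegral_comp_eq_lintegral_kernel hdis hG).trans_le (lintegral_mono_ae ?_)
  filter_upwards [hlevel, hprob] with z hz hz1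
  rw [hz]
  refine lintegral_mono fun x₂ => ?_
  have hswap : Measurable fun q : X × X => ‖S.p τ q.1 q.2 - S.p τ x₂ q.2‖ₑ :=
    (hp.sub (hp.comp (measurable_const.prodMk measurable_snd))).enorm
  rw [lintegral_lintegral_swap (f := fun x₁ y => ‖S.p τ x₁ y - S.p τ x₂ y‖ₑ) hswap.aemeasurable]
  exact lintegral_mono fun y =>
    enorm_sub_integral_le_lintegral (hp.comp measurable_prodMk_right) (S.p τ x₂ y)

end ReversibleSystem

theorem mainTheorem3 {n r : ℕ} {X : Set (EuclideanSpace ℝ (Fin n))}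
    {Z : Set (EuclideanSpace ℝ (Fin r))} (hZ_pos : 0 < volume Z) (hZ_fin : volume Z < ∞)
    (S : ReversibleSystem X) (τ : ℝ) (hτ : 0 < τ)
    (ξ : C(X, Z)) (hξ : ∀ ϑ : C(X, Z), S.lossL τ ξ ≤ S.lossL τ ϑ)
    (ε : ℝ≥0∞) (hε : ε = S.lossL τ ξ) :
    (S.diffLossL τ ξ ≤ 2 * ε ∧ S.diffLossD τ ξ ≤ 2 * ε) ∧
    (∀ ξL : C(X, Z), (∀ ϑ : C(X, Z), S.diffLossL τ ξL ≤ S.diffLossL τ ϑ) →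
      S.lossL τ ξL ≤ 2 * ε) ∧
    (∀ ξD : C(X, Z), (∀ ϑ : C(X, Z), S.diffLossD τ ξD ≤ S.diffLossD τ ϑ) →
      S.lossL τ ξD ≤ 2 * ε) := by
  subst hε
  have hL : S.diffLossL τ ξ ≤ 2 * S.lossL τ ξ := S.diffLossL_le_two_mul_lossL hτ ξ
  refine ⟨⟨hL, (S.diffLossD_eq_diffLossL hτ ξ).trans_le hL⟩, fun ξL h => ?_, fun ξD h => ?_⟩
  · exact (S.lossL_le_diffLossL hτ ξL).trans ((h ξ).trans hL)
  · refine (S.lossL_le_diffLossL hτ ξD).trans (le_trans ?_ hL)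
    rw [← S.diffLossD_eq_diffLossL hτ ξD, ← S.diffLossD_eq_diffLossL hτ ξ]
    exact h ξ
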